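/- Let $\mathcal M$ and $\mathcal N$ be smooth (Hausdorff) manifolds of dimensions $m$ and $n$, each with a smooth affine connection. For each point $\xi\in\mathcal M$ let $W_\xi\subset \mathrm T_\xi\mathcal M$ be an open neighbourhood of $0$ on which the exponential map $\exp_\xi$ of the connection (the time-one map of its geodesics) is defined and is a diffeomorphism onto an open set $U_\xi=\exp_\xi(W_\xi)$, let $\imath_\xi:\mathrm T_\xi\mathcal M\to\mathbb R^m$ be a linear isomorphism, and let $\vartheta_\xi=\imath_\xi\circ\exp_\xi^{-1}:U_\xi\to\mathbb R^m$ be the resulting normal coordinates. Let $\varphi_y=\jmath_y\circ\exp_y^{-1}:V_y\to\mathbb R^n$ $(y\in\mathcal N)$ be normal coordinates on $\mathcal N$, defined in the same way by linear isomorphisms $\jmath_y:\mathrm T_y\mathcal N\to\mathbb R^n$. On $\mathcal M$ write $\xi\boxplus u=\vartheta_\xi^{-1}(u)$ for $u\in\vartheta_\xi(U_\xi)$ and $\zeta\boxminus\xi=\vartheta_\xi(\zeta)$ for $\zeta\in U_\xi$; define $\boxplus,\boxminus$ on $\mathcal N$ in the same way through $\varphi$. Let $h:\mathcal M\to\mathcal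 N$, let $\hat\xi=\hat\xi_{k+1|k}\in\mathcal M$ be the predicted state and $\hat y=h(\hat\xi)$ the predicted output. Assume that $h$ is $C^2$ near $\hat\xi$ and that the frame $y\mapsto\jmath_y^{-1}$ of $\mathrm T\mathcal N$ is differentiable at $\hat y$. Put $$C_{k+1}=\mathrm D\varphi_{\hat y}(\hat y)\cdot \mathrm Dh(\hat\xi)\cdot \mathrm D\vartheta^{-1}_{\hat\xi}(0):\mathbb R^m\to\mathbb R^n .$$ Then there are constants $K$ and $\delta>0$ such that for every state $\xi\in U_{\hat\xi}$ with error $\varepsilon=\xi\boxminus\hat\xi$ satisfying $|\varepsilon|<\delta$, and every noise value $\nu\in\varphi_{h(\xi)}(V_{h(\xi)})$ with $|\nu|<\delta$ (in particular for every such realization of a random noise), the measurement $y=h(\xi)\boxplus\nu$ lies in $V_{\hat y}$ and the innovation $\tilde y=y\boxminus\hat y$ satisfies $$\bigl|\tilde y-(C_{k+1}\varepsilon+\nu)\bigr|\le K\,(|\varepsilon|^2+|\nu|^2),$$ that is, $\tilde y=C_{k+1}\varepsilon+\nu+O(|\varepsilon,\nu|^2)$. -/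

import Mathlib

open scoped Manifold ContDiff Topology

noncomputable section

namespace ManifoldEKF

/-- Affine connections on an `m`-dimensional manifold `M`: covariant derivatives on the tangent
bundle of `M`. In Mathlib's argument order, `conn Y x (X x)` is `(∇_X Y)(x)`. -/
abbrev AffineConnection (m : ℕ) (M : Type*) [TopologicalSpace M]
    [ChartedSpace (EuclideanSpace ℝ (Fin m)) M] [IsManifold (𝓡 m) ∞ M] : Type _ :=
  CovariantDerivative (𝓡 m) (EuclideanSpace ℝ (Fin m))
    (fun x : M => TangentSpace (𝓡 m) x)

section Geodesics

variable {m : ℕ} {M : Type*} [TopologicalSpace M]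
  [ChartedSpace (EuclideanSpace ℝ (Fin m)) M] [IsManifold (𝓡 m) ∞ M]

/-- The components of a tangent vector `v` at `x` in the coordinate frame `∂₁, …, ∂ₘ` of the chart
at `x₀` (meaningful for `x` in the domain of that chart). -/
def components (x₀ : M) {x : M} (v : TangentSpace (𝓡 m) x) : EuclideanSpace ℝ (Fin m) :=
  (trivializationAt (EuclideanSpace ℝ (Fin m))
    (fun x : M => TangentSpace (𝓡 m) x) x₀ ⟨x, v⟩).2

/-- The vector field `∑ i, aᵢ ∂ᵢ` with constant components `a` in the coordinate frame of the chart
at `x₀` (and zero outside the domain of that chart). -/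
def coordField (x₀ : M) (a : EuclideanSpace ℝ (Fin m)) (x : M) : TangentSpace (𝓡 m) x :=
  (trivializationAt (EuclideanSpace ℝ (Fin m))
    (fun x : M => TangentSpace (𝓡 m) x) x₀).symm x a

/-- The velocity of a curve. -/
def velocity (γ : ℝ → M) (t : ℝ) : TangentSpace (𝓡 m) (γ t) :=
  mfderiv 𝓘(ℝ, ℝ) (𝓡 m) γ t (1 : ℝ)

/-- The covariant derivative at time `t` of a vector field `X` along a curve `γ`, computed in the
coordinate frame `∂ᵢ` of the chart at `x₀` (whose domain should contain `γ t`): if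
`X = ∑ i, Xᵢ ∂ᵢ` then it is `∑ i, (Xᵢ'(t) ∂ᵢ + Xᵢ(t) ∇_{γ'(t)} ∂ᵢ)`. -/
def covDerivAlong (conn : AffineConnection m M) (x₀ : M) (γ : ℝ → M)
    (X : ∀ t, TangentSpace (𝓡 m) (γ t)) (t : ℝ) : TangentSpace (𝓡 m) (γ t) :=
  coordField x₀ (deriv (fun s => components x₀ (X s)) t) (γ t)
    + conn (coordField x₀ (components x₀ (X t))) (γ t) (velocity γ t)

/-- A curve `γ` is a geodesic on `J` (an open interval in the uses below) if it is smooth there and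
`∇_{γ'} γ' = 0`; the equation does not depend on the chart in which it is written. -/
structure IsGeodesicOn (conn : AffineConnection m M) (γ : ℝ → M) (J : Set ℝ) : Prop where
  smooth : ContMDiffOn 𝓘(ℝ, ℝ) (𝓡 m) ∞ γ J
  covDeriv_velocity : ∀ t ∈ J, ∀ x₀ : M,
    γ t ∈ (chartAt (EuclideanSpace ℝ (Fin m)) x₀).source →
      covDerivAlong conn x₀ γ (velocity γ) t = 0

/-- `z` is reached at time `1` by a geodesic that starts from `ξ` with velocity `v`. -/
def ExpRel (conn : AffineConnection m M) (ξ : M) (v : TangentSpace (𝓡 m) ξ) (z : M) : Prop :=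
  ∃ (γ : ℝ → M) (J : Set ℝ), IsOpen J ∧ J.OrdConnected ∧ 0 ∈ J ∧ 1 ∈ J ∧
    IsGeodesicOn conn γ J ∧
    (⟨γ 0, velocity γ 0⟩ : TangentBundle (𝓡 m) M) = ⟨ξ, v⟩ ∧ γ 1 = z

/-- The vectors at `ξ` whose geodesic is defined at least up to time `1`. -/
def expDomain (conn : AffineConnection m M) (ξ : M) : Set (TangentSpace (𝓡 m) ξ) :=
  {v | ∃ z, ExpRel conn ξ v z}

open Classical in
/-- The exponential map of the connection at `ξ` (with junk value `ξ` outside `expDomain`). -/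
def expMap (conn : AffineConnection m M) (ξ : M) (v : TangentSpace (𝓡 m) ξ) : M :=
  if hv : ∃ z, ExpRel conn ξ v z then hv.choose else ξ

/-- The inverse of the exponential map at `ξ` restricted to `W`. -/
def expInv (conn : AffineConnection m M) (ξ : M) (W : Set (TangentSpace (𝓡 m) ξ)) (z : M) :
    TangentSpace (𝓡 m) ξ :=
  Function.invFunOn (expMap conn ξ) W z

/-- `W` is an open neighbourhood of zero in the tangent space at `ξ` on which the exponential map
is defined and is a diffeomorphism onto an open subset of `M`. The tangent space is the model
vector space, with its usual smooth structure. -/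
structure IsNormalDomain (conn : AffineConnection m M) (ξ : M)
    (W : Set (TangentSpace (𝓡 m) ξ)) : Prop where
  isOpen : IsOpen W
  zero_mem : 0 ∈ W
  subset_expDomain : W ⊆ expDomain conn ξ
  injOn : Set.InjOn (expMap conn ξ) W
  isOpen_image : IsOpen (expMap conn ξ '' W)
  smooth : ContMDiffOn (M := EuclideanSpace ℝ (Fin m))
    𝓘(ℝ, EuclideanSpace ℝ (Fin m)) (𝓡 m) ∞ (fun v : EuclideanSpace ℝ (Fin m) => expMap conn ξ v) W
  smooth_inv : ContMDiffOn (M' := EuclideanSpace ℝ (Fin m))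
    (𝓡 m) 𝓘(ℝ, EuclideanSpace ℝ (Fin m)) ∞ (fun z => expInv conn ξ W z) (expMap conn ξ '' W)

/-- The data that determine normal coordinates around every point `ξ` of `M`: an open set
`W ξ` of tangent vectors on which the exponential map is a diffeomorphism, and a linear isomorphism
`iso ξ` from the tangent space at `ξ` to `ℝᵐ`. -/
structure NormalCoordinates (conn : AffineConnection m M) where
  W : ∀ ξ : M, Set (TangentSpace (𝓡 m) ξ)
  isNormalDomain : ∀ ξ : M, IsNormalDomain conn ξ (W ξ)
  iso : ∀ ξ : M, TangentSpace (𝓡 m) ξ ≃L[ℝ] EuclideanSpace ℝ (Fin m)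

namespace NormalCoordinates

variable {conn : AffineConnection m M} (c : NormalCoordinates conn)

/-- The domain `U_ξ = exp_ξ (W_ξ)` of the normal coordinates around `ξ`. -/
def U (ξ : M) : Set M := expMap conn ξ '' c.W ξ

/-- The range `iso_ξ (W_ξ)` of the normal coordinates around `ξ`. -/
def range (ξ : M) : Set (EuclideanSpace ℝ (Fin m)) := c.iso ξ '' c.W ξ

/-- The normal coordinates `iso_ξ ∘ exp_ξ⁻¹` around `ξ`, a map from `U_ξ` to `ℝᵐ`. -/
def coord (ξ : M) (ζ : M) : EuclideanSpace ℝ (Fin m) := c.iso ξ (expInv conn ξ (c.W ξ) ζ)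

/-- The inverse `exp_ξ ∘ iso_ξ⁻¹` of the normal coordinates around `ξ`, on `c.range ξ`. -/
def coordInv (ξ : M) (u : EuclideanSpace ℝ (Fin m)) : M := expMap conn ξ ((c.iso ξ).symm u)

/-- `ξ ⊞ u`, for `u ∈ c.range ξ`. -/
def boxplus (ξ : M) (u : EuclideanSpace ℝ (Fin m)) : M := c.coordInv ξ u

/-- `ζ ⊟ ξ`, for `ζ ∈ c.U ξ`. -/
def boxminus (ζ ξ : M) : EuclideanSpace ℝ (Fin m) := c.coord ξ ζ

/-- The frame `ξ ↦ iso_ξ⁻¹` of the tangent bundle that is used to write tangent vectors as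
elements of `ℝᵐ` depends differentiably on the base point at `ξ₀`. -/
def FrameDifferentiableAt (ξ₀ : M) : Prop :=
  ∀ u : EuclideanSpace ℝ (Fin m),
    MDifferentiableAt (𝓡 m) (𝓡 m).tangent
      (fun ξ => (⟨ξ, (c.iso ξ).symm u⟩ : TangentBundle (𝓡 m) M)) ξ₀

end NormalCoordinates

end Geodesics

/-- The output matrix `Dφ_ŷ(ŷ) · Dh(ξ̂) · Dϑ_ξ̂⁻¹(0)` with `ŷ = h ξ̂`, where `ϑ` and `φ` are the
normal coordinates on `M` and `N`. -/
def outputMatrix {m n : ℕ} {M N : Type*}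
    [TopologicalSpace M] [ChartedSpace (EuclideanSpace ℝ (Fin m)) M] [IsManifold (𝓡 m) ∞ M]
    [TopologicalSpace N] [ChartedSpace (EuclideanSpace ℝ (Fin n)) N] [IsManifold (𝓡 n) ∞ N]
    {connM : AffineConnection m M} {connN : AffineConnection n N}
    (ϑ : NormalCoordinates connM) (φ : NormalCoordinates connN) (h : M → N) (ξhat : M) :
    EuclideanSpace ℝ (Fin m) →L[ℝ] EuclideanSpace ℝ (Fin n) :=
  (mfderiv (𝓡 n) 𝓘(ℝ, EuclideanSpace ℝ (Fin n)) (φ.coord (h ξhat)) (h ξhat)).comp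
    ((mfderiv (𝓡 m) (𝓡 n) h ξhat).comp
      (mfderiv 𝓘(ℝ, EuclideanSpace ℝ (Fin m)) (𝓡 m) (ϑ.coordInv ξhat) 0))

end ManifoldEKF

end

/-!
The proof works in the chart `ψ` of `N` at the predicted output `ŷ = h ξhat`, and needs neither
existence, nor uniqueness, nor smooth dependence of geodesics on their initial data: the point
`exp_y v` is by definition the endpoint of *some* geodesic on `[0, 1]`, so it suffices to control
every such geodesic that starts near `ŷ` with small velocity.

In the chart the geodesic equation reads `x'' = -Γ(x)(x', x')`, with `Γ` bounded near `ŷ`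
(`eventually_norm_components_conn_le`). As long as the curve stays in a fixed compact ball with
`‖x'‖ ≤ 1`, Grönwall's inequality gives `‖x'‖ ≤ e^C ‖x'(0)‖`, and hence
`x(1) = x(0) + x'(0) + O(‖x'(0)‖²)` (`norm_bounds_of_deriv_le_sq`). For small initial velocity the
first bound keeps the curve strictly inside the ball, so a continuity argument shows that it never
leaves it; this is `exists_expRel_estimate`. The estimate is uniform in the starting point, although
nothing relates the normal domains of different points to each other.

At `ŷ` itself the estimate shows `exp_ŷ 0 = ŷ` and that the differential of `exp_ŷ` at `0` is the
identity. So, if `f` is the expression of the normal coordinates `φ_ŷ` in the chart and `A y` is the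
matrix of the frame at `y`, then `Df(ψ ŷ) ∘ A ŷ = id` (`fderiv_coordInChart_comp_frameMap`).
Away from `ŷ`, with `g = ψ ∘ h ∘ ϑ⁻¹`,
`ψ (h ξ ⊞ ν) = g ε + A (h ξ) ν + O(‖ν‖²) = ψ ŷ + Dg(0) ε + A(ŷ) ν + O(‖ε‖² + ‖ν‖²)`,
the second equality by Taylor's formula for `g` and the differentiability of the frame at `ŷ`.
Applying `f`, which is smooth and vanishes at `ψ ŷ`, yields
`ỹ = Df(ψ ŷ) (Dg(0) ε) + ν + O(‖ε‖² + ‖ν‖²)`, and `Df(ψ ŷ) ∘ Dg(0)` is the output matrix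
(`innovation_isBigO`).
-/

namespace ManifoldEKF

open Asymptotics Set Filter

/-! ### Calculus estimates -/

section Analysis

variable {E F : Type*} [NormedAddCommGroup E] [NormedSpace ℝ E]
  [NormedAddCommGroup F] [NormedSpace ℝ F]

/-- First-order Taylor expansion of a `C²` map with quadratic remainder: the derivative is locally
Lipschitz, so the mean value inequality applies to `f - Df(x)`. -/
theorem taylor_isBigO_sq {f : E → F} {x : E} (hf : ContDiffAt ℝ 2 f x) :
    (fun y => f y - f x - fderiv ℝ f x (y - x)) =O[𝓝 x] fun y => ‖y - x‖ ^ 2 := by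
  obtain ⟨K, t, ht, hK⟩ := (hf.fderiv_right (m := 1) le_rfl).exists_lipschitzOnWith
  have hd : ∀ᶠ y in 𝓝 x, DifferentiableAt ℝ f y :=
    (hf.eventually (by simp)).mono fun y hy => hy.differentiableAt (by simp)
  obtain ⟨r, hr, hball⟩ := Metric.mem_nhds_iff.1 (Filter.inter_mem ht hd)
  refine IsBigO.of_bound K ?_
  filter_upwards [Metric.ball_mem_nhds x hr] with y hy
  have hsub : Metric.closedBall x ‖y - x‖ ⊆ Metric.ball x r :=
    Metric.closedBall_subset_ball (by simpa [dist_eq_norm] using hy)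
  have key := (convex_closedBall x ‖y - x‖).norm_image_sub_le_of_norm_fderiv_le'
    (f := f) (φ := fderiv ℝ f x) (C := K * ‖y - x‖) (x := x) (y := y)
    (fun z hz => (hball (hsub hz)).2) (fun z hz => ?_)
    (Metric.mem_closedBall_self (norm_nonneg _)) (by simp [dist_eq_norm])
  · rw [norm_pow, norm_norm, pow_two, ← mul_assoc]
    exact key
  · refine (hK.norm_sub_le (hball (hsub hz)).1 (mem_of_mem_nhds ht)).trans ?_
    have : ‖z - x‖ ≤ ‖y - x‖ := by simpa [dist_eq_norm] using hz
    gcongr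

/-- A priori bounds for a curve `x` with velocity `u` and quadratically bounded acceleration on an
interval `[0, T]` of length at most `1`. While the speed is at most `1`, the acceleration is at most
`C * ‖u‖`, which makes Grönwall's inequality applicable; the resulting bound on the speed is fed
back into the quadratic bound. -/
theorem norm_bounds_of_deriv_le_sq {x u u' : ℝ → E} {C T : ℝ} (hC : 0 ≤ C)
    (hT₁ : T ≤ 1) (hx : ∀ t ∈ Icc 0 T, HasDerivAt x (u t) t)
    (hu : ∀ t ∈ Icc 0 T, HasDerivAt u (u' t) t) (hu' : ∀ t ∈ Icc 0 T, ‖u' t‖ ≤ C * ‖u t‖ ^ 2)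
    (hle : ∀ t ∈ Icc 0 T, ‖u t‖ ≤ 1) {t : ℝ} (ht : t ∈ Icc 0 T) :
    ‖u t‖ ≤ ‖u 0‖ * Real.exp C ∧ ‖x t - x 0‖ ≤ ‖u 0‖ * Real.exp C ∧
      ‖x t - x 0 - t • u 0‖ ≤ C * Real.exp C ^ 2 * ‖u 0‖ ^ 2 := by
  have hbound : ∀ t ∈ Icc 0 T, ‖u t‖ ≤ ‖u 0‖ * Real.exp C := by
    intro t ht
    have h₁ := norm_le_gronwallBound_of_norm_deriv_right_le (f := u) (f' := u') (δ := ‖u 0‖)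
      (K := C) (ε := 0) (a := 0) (b := T)
      (fun s hs => (hu s hs).continuousAt.continuousWithinAt)
      (fun s hs => (hu s (Ico_subset_Icc_self hs)).hasDerivWithinAt) le_rfl
      (fun s hs => by
        have h₂ := hle s (Ico_subset_Icc_self hs)
        have h₃ : ‖u s‖ ^ 2 ≤ ‖u s‖ := by nlinarith [norm_nonneg (u s)]
        have := mul_le_mul_of_nonneg_left h₃ hC
        linarith [hu' s (Ico_subset_Icc_self hs)]) t ht
    rw [gronwallBound_ε0, sub_zero] at h₁
    refine h₁.trans ?_
    have : C * t ≤ C := mul_le_of_le_one_right hC (ht.2.trans hT₁)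
    gcongr
  -- A derivative bound `B` on `[0, T]`, with `T ≤ 1`, bounds the increment from `0` by `B`.
  have hmv : ∀ {g g' : ℝ → E} {B : ℝ}, 0 ≤ B → (∀ t ∈ Icc 0 T, HasDerivAt g (g' t) t) →
      (∀ t ∈ Icc 0 T, ‖g' t‖ ≤ B) → ∀ t ∈ Icc 0 T, ‖g t - g 0‖ ≤ B := by
    intro g g' B hB hg hg' t ht
    have := norm_image_sub_le_of_norm_deriv_le_segment' (f := g) (f' := g') (C := B)
      (a := 0) (b := T) (fun s hs => (hg s hs).hasDerivWithinAt)
      (fun s hs => hg' s (Ico_subset_Icc_self hs)) t ht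
    refine this.trans (mul_le_of_le_one_right hB ?_)
    linarith [ht.2]
  refine ⟨hbound t ht, hmv (by positivity) hx hbound t ht, ?_⟩
  have hB : 0 ≤ C * Real.exp C ^ 2 * ‖u 0‖ ^ 2 := by positivity
  have hu0 : ∀ t ∈ Icc 0 T, ‖u t - u 0‖ ≤ C * Real.exp C ^ 2 * ‖u 0‖ ^ 2 := by
    refine hmv hB hu fun s hs => (hu' s hs).trans ?_
    calc C * ‖u s‖ ^ 2 ≤ C * (‖u 0‖ * Real.exp C) ^ 2 := by gcongr; exact hbound s hs
      _ = _ := by ring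
  have := hmv (g := fun s => x s - s • u 0) hB
    (fun s hs => (hx s hs).sub ((hasDerivAt_id s).smul_const (u 0)))
    (fun s hs => by simpa using hu0 s hs) t ht
  convert this using 2
  simp only [zero_smul, sub_zero]
  abel

end Analysis

/-! ### Coordinate fields and the Christoffel symbols -/

section Coordinates

variable {m : ℕ} {M : Type*} [TopologicalSpace M]
  [ChartedSpace (EuclideanSpace ℝ (Fin m)) M] [IsManifold (𝓡 m) ∞ M]

local notation "𝔼" => EuclideanSpace ℝ (Fin m)

theorem components_eq_continuousLinearMapAt {x₀ x : M} (hx : x ∈ (chartAt 𝔼 x₀).source)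
    (v : TangentSpace (𝓡 m) x) :
    components x₀ v = (trivializationAt 𝔼
      (fun x : M => TangentSpace (𝓡 m) x) x₀).continuousLinearMapAt ℝ x v := by
  rw [Bundle.Trivialization.continuousLinearMapAt_apply,
    Bundle.Trivialization.coe_linearMapAt_of_mem _ hx]
  rfl

theorem components_add {x₀ x : M} (hx : x ∈ (chartAt 𝔼 x₀).source)
    (v w : TangentSpace (𝓡 m) x) :
    components x₀ (v + w) = components x₀ v + components x₀ w := by
  simp only [components_eq_continuousLinearMapAt hx, map_add]

theorem components_zero {x₀ x : M} (hx : x ∈ (chartAt 𝔼 x₀).source) :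
    components x₀ (0 : TangentSpace (𝓡 m) x) = 0 := by
  simp only [components_eq_continuousLinearMapAt hx, map_zero]

theorem coordField_eq_symmL {x₀ x : M} (hx : x ∈ (chartAt 𝔼 x₀).source) (a : 𝔼) :
    coordField x₀ a x = (trivializationAt 𝔼
      (fun x : M => TangentSpace (𝓡 m) x) x₀).symmL ℝ x a := by
  rw [Bundle.Trivialization.symmL_apply _ hx]
  rfl

theorem coordField_add {x₀ x : M} (hx : x ∈ (chartAt 𝔼 x₀).source) (a b : 𝔼) :
    coordField x₀ (a + b) x = coordField x₀ a x + coordField x₀ b x := by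
  simp only [coordField_eq_symmL hx, map_add]

theorem coordField_smul {x₀ x : M} (hx : x ∈ (chartAt 𝔼 x₀).source) (c : ℝ) (a : 𝔼) :
    coordField x₀ (c • a) x = c • coordField x₀ a x := by
  simp only [coordField_eq_symmL hx, map_smul]

theorem components_coordField {x₀ x : M} (hx : x ∈ (chartAt 𝔼 x₀).source) (a : 𝔼) :
    components x₀ (coordField x₀ a x) = a := by
  rw [components_eq_continuousLinearMapAt hx, coordField_eq_symmL hx]
  exact Bundle.Trivialization.continuousLinearMapAt_symmL _ hx a

theorem coordField_components {x₀ x : M} (hx : x ∈ (chartAt 𝔼 x₀).source)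
    (v : TangentSpace (𝓡 m) x) : coordField x₀ (components x₀ v) x = v := by
  rw [components_eq_continuousLinearMapAt hx, coordField_eq_symmL hx]
  exact Bundle.Trivialization.symmL_continuousLinearMapAt _ hx v

theorem components_eq_mfderiv {x₀ x : M} (hx : x ∈ (chartAt 𝔼 x₀).source)
    (v : TangentSpace (𝓡 m) x) :
    components x₀ v = mfderiv (𝓡 m) 𝓘(ℝ, 𝔼) (extChartAt (𝓡 m) x₀) x v := by
  rw [components_eq_continuousLinearMapAt hx]
  have : IsManifold (𝓡 m) 1 M := IsManifold.of_le (n := ∞) (by simp)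
  rw [TangentBundle.continuousLinearMapAt_trivializationAt hx]
  rfl

theorem contMDiffOn_coordField (x₀ : M) (a : 𝔼) :
    ContMDiffOn (𝓡 m) ((𝓡 m).prod 𝓘(ℝ, 𝔼)) ∞
      (fun x => (⟨x, coordField x₀ a x⟩ :
        Bundle.TotalSpace 𝔼 (fun x : M => TangentSpace (𝓡 m) x)))
      (chartAt 𝔼 x₀).source := by
  have h := (trivializationAt 𝔼 (fun x : M => TangentSpace (𝓡 m) x)
    x₀).contMDiffOn_section_baseSet_iff (IB := 𝓡 m) (n := ∞) (s := coordField x₀ a)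
  exact h.2 ((contMDiffOn_const (c := a)).congr fun x hx => components_coordField hx a)

/-- The germ at `x₀` of a coordinate field is the germ of a globally smooth field, namely of its
product with a bump function. The smoothness of a connection is a statement about global sections,
so this is what makes it available for coordinate fields. -/
theorem exists_contMDiff_eventuallyEq_coordField [T2Space M] (x₀ : M) (a : 𝔼) :
    ∃ σ : ∀ x : M, TangentSpace (𝓡 m) x,
      ContMDiff (𝓡 m) ((𝓡 m).prod 𝓘(ℝ, 𝔼)) ∞ (fun x => (⟨x, σ x⟩ :
        Bundle.TotalSpace 𝔼 (fun x : M => TangentSpace (𝓡 m) x))) ∧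
      ∀ᶠ x in 𝓝 x₀, σ x = coordField x₀ a x := by
  let ψ : SmoothBumpFunction (𝓡 m) x₀ := Classical.arbitrary _
  refine ⟨(ψ : M → ℝ) • coordField x₀ a, ?_, ?_⟩
  · exact ContMDiffOn.smul_section_of_tsupport ψ.contMDiff.contMDiffOn
      (chartAt 𝔼 x₀).open_source ψ.tsupport_subset_chartAt_source (contMDiffOn_coordField x₀ a)
  · filter_upwards [ψ.eventuallyEq_one] with x hx
    simp [hx]

theorem mdifferentiableAt_coordField {x₀ x : M} (hx : x ∈ (chartAt 𝔼 x₀).source) (a : 𝔼) :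
    MDifferentiableAt (𝓡 m) ((𝓡 m).prod 𝓘(ℝ, 𝔼))
      (fun x => (⟨x, coordField x₀ a x⟩ :
        Bundle.TotalSpace 𝔼 (fun x : M => TangentSpace (𝓡 m) x))) x :=
  ((contMDiffOn_coordField x₀ a).contMDiffAt
    ((chartAt 𝔼 x₀).open_source.mem_nhds hx)).mdifferentiableAt (by simp)

theorem eventually_norm_components_coordField_le [T2Space M] {conn : AffineConnection m M}
    (hconn : CovariantDerivative.ContMDiffCovariantDerivative conn ∞) (x₀ : M) (a : 𝔼) :
    ∃ C : ℝ, ∀ᶠ x in 𝓝 x₀, ∀ w : TangentSpace (𝓡 m) x,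
      ‖components x₀ (conn (coordField x₀ a) x w)‖ ≤ C * ‖components x₀ w‖ := by
  obtain ⟨σ, hσ, hσa⟩ := exists_contMDiff_eventuallyEq_coordField x₀ a
  have h₁ := hconn.contMDiff.contMDiff (σ := σ) (by simpa using hσ.contMDiffOn)
  have h₂ := (((contMDiffAt_hom_bundle _).1
    (h₁.contMDiffAt (x := x₀) univ_mem)).2.continuousAt.norm).eventually_lt_const (lt_add_one _)
  obtain ⟨C, h₂⟩ : ∃ C : ℝ, ∀ᶠ x in 𝓝 x₀,
      ‖ContinuousLinearMap.inCoordinates 𝔼 (fun x : M => TangentSpace (𝓡 m) x) 𝔼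
        (fun x : M => TangentSpace (𝓡 m) x) x₀ x x₀ x (conn σ x)‖ < C := ⟨_, h₂⟩
  refine ⟨C, ?_⟩
  filter_upwards [h₂, hσa.eventually_nhds,
    (chartAt 𝔼 x₀).open_source.mem_nhds (mem_chart_source 𝔼 x₀)] with x hx hσx hxs w
  have hcov : conn σ x = conn (coordField x₀ a) x :=
    conn.isCovariantDerivativeOnUniv.congr_of_eventuallyEq
      (hσ.mdifferentiable (by simp) x) (mdifferentiableAt_coordField hxs a) univ_mem hσx
  have key := (ContinuousLinearMap.inCoordinates 𝔼 (fun x : M => TangentSpace (𝓡 m) x) 𝔼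
    (fun x : M => TangentSpace (𝓡 m) x) x₀ x x₀ x (conn σ x)).le_of_opNorm_le hx.le
    (components x₀ w)
  have hxb : x ∈ (trivializationAt 𝔼 (fun x : M => TangentSpace (𝓡 m) x) x₀).baseSet := hxs
  rwa [ContinuousLinearMap.inCoordinates_eq hxb hxb, hcov, ContinuousLinearMap.comp_apply,
    ContinuousLinearMap.comp_apply, Bundle.Trivialization.coe_continuousLinearEquivAt_eq',
    Bundle.Trivialization.symm_continuousLinearEquivAt_eq', ← coordField_eq_symmL hxs,
    coordField_components hxs, ← components_eq_continuousLinearMapAt hxs] at key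

/-- `coordField` is additive only over the chart domain (outside it takes junk values), so this uses
that a covariant derivative depends only on the germ of the section. -/
theorem conn_coordField_add (conn : AffineConnection m M) {x₀ x : M}
    (hx : x ∈ (chartAt 𝔼 x₀).source) (a b : 𝔼) :
    conn (coordField x₀ (a + b)) x = conn (coordField x₀ a) x + conn (coordField x₀ b) x := by
  have ha := mdifferentiableAt_coordField hx a
  have hb := mdifferentiableAt_coordField hx b
  rw [← conn.isCovariantDerivativeOnUniv.add ha hb]
  exact conn.isCovariantDerivativeOn.congr_of_eqOn (mdifferentiableAt_coordField hx _)
    (mdifferentiableAt_add_section ha hb) ((chartAt 𝔼 x₀).open_source.mem_nhds hx)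
    fun y hy => coordField_add hy a b

theorem conn_coordField_smul (conn : AffineConnection m M) {x₀ x : M}
    (hx : x ∈ (chartAt 𝔼 x₀).source) (c : ℝ) (a : 𝔼) :
    conn (coordField x₀ (c • a)) x = c • conn (coordField x₀ a) x := by
  have ha := mdifferentiableAt_coordField hx a
  rw [← conn.isCovariantDerivativeOnUniv.smul_const c ha]
  exact conn.isCovariantDerivativeOn.congr_of_eqOn (mdifferentiableAt_coordField hx _)
    ha.smul_const_section ((chartAt 𝔼 x₀).open_source.mem_nhds hx)
    fun y hy => coordField_smul hy c a

/-- The Christoffel symbols of a smooth connection in the chart at `x₀` are bounded near `x₀`. -/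
theorem eventually_norm_components_conn_le [T2Space M] {conn : AffineConnection m M}
    (hconn : CovariantDerivative.ContMDiffCovariantDerivative conn ∞) (x₀ : M) :
    ∃ C : ℝ, 0 ≤ C ∧ ∀ᶠ x in 𝓝 x₀, ∀ (a : 𝔼) (w : TangentSpace (𝓡 m) x),
      ‖components x₀ (conn (coordField x₀ a) x w)‖ ≤ C * ‖a‖ * ‖components x₀ w‖ := by
  choose C hC using fun i => eventually_norm_components_coordField_le hconn x₀
    (EuclideanSpace.basisFun (Fin m) ℝ i)
  refine ⟨∑ i, |C i|, Finset.sum_nonneg fun i _ => abs_nonneg _, ?_⟩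
  filter_upwards [eventually_all.2 hC,
    (chartAt 𝔼 x₀).open_source.mem_nhds (mem_chart_source 𝔼 x₀)] with x hx hxs a w
  -- `Γ` sends `b` to the components of `∇_w` of the field with constant components `b`.
  let Γ : 𝔼 →ₗ[ℝ] 𝔼 :=
    { toFun := fun b => components x₀ (conn (coordField x₀ b) x w)
      map_add' := fun b c => by
        rw [conn_coordField_add conn hxs]
        simp only [components_eq_continuousLinearMapAt hxs, add_apply, map_add]
      map_smul' := fun b c => by
        rw [conn_coordField_smul conn hxs]
        simp only [components_eq_continuousLinearMapAt hxs, smul_apply, map_smul,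
          RingHom.id_apply] }
  have ha : a = ∑ i, a i • EuclideanSpace.basisFun (Fin m) ℝ i := by
    simpa using ((EuclideanSpace.basisFun (Fin m) ℝ).sum_repr a).symm
  change ‖Γ a‖ ≤ _
  conv_lhs => rw [ha]
  rw [map_sum, Finset.sum_mul, Finset.sum_mul]
  refine norm_sum_le_of_le _ fun i _ => ?_
  rw [map_smul, norm_smul]
  calc ‖a i‖ * ‖Γ (EuclideanSpace.basisFun (Fin m) ℝ i)‖
      ≤ ‖a‖ * (|C i| * ‖components x₀ w‖) := by
        gcongr
        · exact PiLp.norm_apply_le a i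
        · exact (hx i w).trans (by gcongr; exact le_abs_self _)
    _ = _ := by ring

end Coordinates

/-! ### Geodesics in a chart -/

section Geodesics

variable {m : ℕ} {M : Type*} [TopologicalSpace M]
  [ChartedSpace (EuclideanSpace ℝ (Fin m)) M] [IsManifold (𝓡 m) ∞ M]

local notation "𝔼" => EuclideanSpace ℝ (Fin m)

theorem components_velocity {x₀ : M} {γ : ℝ → M} {t : ℝ}
    (hγ : MDifferentiableAt 𝓘(ℝ, ℝ) (𝓡 m) γ t) (ht : γ t ∈ (chartAt 𝔼 x₀).source) :
    components x₀ (velocity γ t) = deriv (fun s => extChartAt (𝓡 m) x₀ (γ s)) t := by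
  rw [components_eq_mfderiv ht, ← fderiv_apply_one_eq_deriv, ← mfderiv_eq_fderiv]
  exact congrArg (fun L : ℝ →L[ℝ] 𝔼 => L 1)
    (mfderiv_comp t (mdifferentiableAt_extChartAt ht) hγ).symm

theorem contDiffAt_extChartAt_comp {x₀ : M} {γ : ℝ → M} {t : ℝ}
    (hγ : ContMDiffAt 𝓘(ℝ, ℝ) (𝓡 m) ∞ γ t) (ht : γ t ∈ (chartAt 𝔼 x₀).source) :
    ContDiffAt ℝ ∞ (fun s => extChartAt (𝓡 m) x₀ (γ s)) t :=
  contMDiffAt_iff_contDiffAt.1 ((contMDiffAt_extChartAt' ht).comp t hγ)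

theorem hasDerivAt_extChartAt_comp {x₀ : M} {γ : ℝ → M} {t : ℝ}
    (hγ : ContMDiffAt 𝓘(ℝ, ℝ) (𝓡 m) ∞ γ t) (ht : γ t ∈ (chartAt 𝔼 x₀).source) :
    HasDerivAt (fun s => extChartAt (𝓡 m) x₀ (γ s)) (components x₀ (velocity γ t)) t := by
  rw [components_velocity (hγ.mdifferentiableAt (by simp)) ht]
  exact ((contDiffAt_extChartAt_comp hγ ht).differentiableAt (by simp)).hasDerivAt

theorem hasDerivAt_components_velocity {x₀ : M} {γ : ℝ → M} {t : ℝ}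
    (hγ : ContMDiffAt 𝓘(ℝ, ℝ) (𝓡 m) ∞ γ t) (ht : γ t ∈ (chartAt 𝔼 x₀).source) :
    HasDerivAt (fun s => components x₀ (velocity (m := m) γ s))
      (deriv (fun s => components x₀ (velocity (m := m) γ s)) t) t := by
  have h₁ : DifferentiableAt ℝ (deriv fun s => extChartAt (𝓡 m) x₀ (γ s)) t := by
    have := ((contDiffAt_extChartAt_comp hγ ht).fderiv_right (m := ∞)
      le_rfl).differentiableAt (by simp)
    simpa only [fderiv_apply_one_eq_deriv] using this.clm_apply (differentiableAt_const (1 : ℝ))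
  refine (h₁.congr_of_eventuallyEq ?_).hasDerivAt
  filter_upwards [contMDiffAt_iff_contMDiffAt_nhds (by simp) |>.1
      (hγ.of_le (m := 1) (by simp)),
    hγ.continuousAt.preimage_mem_nhds ((chartAt 𝔼 x₀).open_source.mem_nhds ht)] with s hs hs'
  exact components_velocity (hs.mdifferentiableAt (by simp)) hs'

/-- The geodesic equation `x'' = -Γ(x)(x', x')` in the chart at `x₀`. -/
theorem IsGeodesicOn.deriv_components_velocity {conn : AffineConnection m M} {γ : ℝ → M}
    {J : Set ℝ} (hγ : IsGeodesicOn conn γ J) {t : ℝ} (htJ : t ∈ J) {x₀ : M}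
    (ht : γ t ∈ (chartAt 𝔼 x₀).source) :
    deriv (fun s => components x₀ (velocity γ s)) t =
      -components x₀ (conn (coordField x₀ (components x₀ (velocity γ t))) (γ t)
        (velocity γ t)) := by
  have h := congrArg (components x₀) (hγ.covDeriv_velocity t htJ x₀ ht)
  rw [covDerivAlong, components_add ht, components_zero ht, components_coordField ht] at h
  exact eq_neg_of_add_eq_zero_left h

/-- Endpoints of geodesics with small initial velocity `v` from points `x` near `x₀`: in the chart at
`x₀` they are `x + v + O(‖v‖²)`, uniformly in `x` and in the choice of the geodesic. -/
theorem exists_expRel_estimate [T2Space M] {conn : AffineConnection m M}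
    (hconn : CovariantDerivative.ContMDiffCovariantDerivative conn ∞) (x₀ : M) :
    ∃ C δ : ℝ, 0 < δ ∧ ∀ᶠ x in 𝓝 x₀, ∀ (v : TangentSpace (𝓡 m) x) (z : M),
      ExpRel conn x v z → ‖components x₀ v‖ < δ →
        z ∈ (chartAt 𝔼 x₀).source ∧
        ‖extChartAt (𝓡 m) x₀ z - extChartAt (𝓡 m) x₀ x - components x₀ v‖
          ≤ C * ‖components x₀ v‖ ^ 2 := by
  set ψ := extChartAt (𝓡 m) x₀
  have hsrc : ψ.source = (chartAt 𝔼 x₀).source := extChartAt_source _ _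
  obtain ⟨C, hC, hΓ⟩ := eventually_norm_components_conn_le hconn x₀
  -- A closed ball in the chart on whose preimage `A` the Christoffel symbols are bounded by `C`.
  obtain ⟨r, hr, hball⟩ : ∃ r > 0, Metric.closedBall (ψ x₀) r ⊆ ψ.target ∩
      {p | ∀ (a : 𝔼) (w : TangentSpace (𝓡 m) (ψ.symm p)),
        ‖components x₀ (conn (coordField x₀ a) (ψ.symm p) w)‖
          ≤ C * ‖a‖ * ‖components x₀ w‖} := by
    refine Metric.nhds_basis_closedBall.mem_iff.1 (inter_mem (extChartAt_target_mem_nhds x₀) ?_)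
    have := (continuousAt_extChartAt_symm (I := 𝓡 m) x₀)
    rw [ContinuousAt, extChartAt_to_inv] at this
    exact this hΓ
  set A : Set M := ψ.symm '' Metric.closedBall (ψ x₀) r
  have hA_mem : ∀ x, x ∈ A ↔ x ∈ ψ.source ∧ ‖ψ x - ψ x₀‖ ≤ r := by
    intro x
    constructor
    · rintro ⟨p, hp, rfl⟩
      refine ⟨ψ.map_target (hball hp).1, ?_⟩
      rw [ψ.right_inv (hball hp).1]
      simpa [dist_eq_norm] using hp
    · rintro ⟨hx, hx'⟩
      exact ⟨ψ x, by simpa [dist_eq_norm] using hx', ψ.left_inv hx⟩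
  -- The Hausdorff property enters here: a compact set is closed.
  have hA_closed : IsClosed A :=
    ((isCompact_closedBall (ψ x₀) r).image_of_continuousOn
      ((continuousOn_extChartAt_symm x₀).mono fun p hp => (hball hp).1)).isClosed
  have hA_bound : ∀ x ∈ A, ∀ (a : 𝔼) (w : TangentSpace (𝓡 m) x),
      ‖components x₀ (conn (coordField x₀ a) x w)‖ ≤ C * ‖a‖ * ‖components x₀ w‖ := by
    rintro _ ⟨p, hp, rfl⟩
    exact (hball hp).2
  refine ⟨C * Real.exp C ^ 2, min (r / 2) 1 / Real.exp C, by positivity, ?_⟩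
  have hnear : ∀ᶠ x in 𝓝 x₀, ‖ψ x - ψ x₀‖ < r / 2 := by
    have := (continuousAt_extChartAt (I := 𝓡 m) x₀).sub_const (ψ x₀) |>.norm
    exact this.eventually_lt_const (by rw [sub_self, norm_zero]; exact half_pos hr)
  filter_upwards [hnear, extChartAt_source_mem_nhds (I := 𝓡 m) x₀] with x hx hxs v z hz hv
  obtain ⟨γ, J, hJo, hJc, h0J, h1J, hγ, hγ0, rfl⟩ := hz
  have hγ0x : γ 0 = x := congrArg Bundle.TotalSpace.proj hγ0
  have hu0 : components x₀ (velocity γ 0) = components x₀ v :=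
    congrArg (fun p : TangentBundle (𝓡 m) M => (trivializationAt 𝔼
      (fun x : M => TangentSpace (𝓡 m) x) x₀ p).2) hγ0
  have hIJ : Icc (0 : ℝ) 1 ⊆ J := hJc.out h0J h1J
  have hsm : ∀ t ∈ Icc (0 : ℝ) 1, ContMDiffAt 𝓘(ℝ, ℝ) (𝓡 m) ∞ γ t := fun t ht =>
    hγ.smooth.contMDiffAt (hJo.mem_nhds (hIJ ht))
  set u : ℝ → 𝔼 := fun t => components x₀ (velocity γ t) with hu
  rw [lt_div_iff₀ (Real.exp_pos C), ← hu0] at hv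
  have hvr : ‖u 0‖ * Real.exp C < r / 2 := hv.trans_le (min_le_left _ _)
  have hv1 : ‖u 0‖ * Real.exp C < 1 := hv.trans_le (min_le_right _ _)
  -- `G` is the set of times at which the curve is in `A` with coordinate speed at most `1`.
  set G : Set ℝ := {t | γ t ∈ A ∧ ‖u t‖ ≤ 1} with hG
  have hest : ∀ T ∈ Icc (0 : ℝ) 1, Icc 0 T ⊆ G →
      ‖u T‖ ≤ ‖u 0‖ * Real.exp C ∧ ‖ψ (γ T) - ψ (γ 0)‖ ≤ ‖u 0‖ * Real.exp C ∧
        ‖ψ (γ T) - ψ (γ 0) - T • u 0‖ ≤ C * Real.exp C ^ 2 * ‖u 0‖ ^ 2 := by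
    intro T hT hTG
    have hs : ∀ t ∈ Icc 0 T, t ∈ Icc (0 : ℝ) 1 ∧ γ t ∈ (chartAt 𝔼 x₀).source := fun t ht =>
      ⟨⟨ht.1, ht.2.trans hT.2⟩, hsrc ▸ ((hA_mem _).1 (hTG ht).1).1⟩
    refine norm_bounds_of_deriv_le_sq (x := fun t => ψ (γ t)) (u := u) (u' := deriv u) hC hT.2
      (fun t ht => hasDerivAt_extChartAt_comp (hsm t (hs t ht).1) (hs t ht).2)
      (fun t ht => hasDerivAt_components_velocity (hsm t (hs t ht).1) (hs t ht).2)
      (fun t ht => ?_) (fun t ht => (hTG ht).2) (right_mem_Icc.2 hT.1)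
    rw [hu, hγ.deriv_components_velocity (hIJ (hs t ht).1) (hs t ht).2, norm_neg, pow_two,
      ← mul_assoc]
    exact hA_bound _ (hTG ht).1 _ _
  have hγc : ContinuousOn γ (Icc 0 1) := fun t ht => (hsm t ht).continuousAt.continuousWithinAt
  have hGclosed : IsClosed (G ∩ Icc 0 1) := by
    have h₁ : IsClosed (Icc (0 : ℝ) 1 ∩ γ ⁻¹' A) := hγc.preimage_isClosed_of_isClosed isClosed_Icc
      hA_closed
    have h₂ : ContinuousOn u (Icc (0 : ℝ) 1 ∩ γ ⁻¹' A) := fun t ht =>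
      (hasDerivAt_components_velocity (hsm t ht.1)
        (hsrc ▸ ((hA_mem _).1 ht.2).1)).continuousAt.continuousWithinAt
    convert h₂.norm.preimage_isClosed_of_isClosed h₁ (isClosed_Iic (a := (1 : ℝ))) using 1
    ext t
    simp only [hG, mem_inter_iff, mem_ofPred_eq, mem_preimage, mem_Iic]
    tauto
  have hG0 : (0 : ℝ) ∈ G := by
    refine ⟨(hA_mem _).2 ⟨by rwa [hγ0x], by rw [hγ0x]; linarith⟩, ?_⟩
    have : ‖u 0‖ * 1 ≤ ‖u 0‖ * Real.exp C := by
      gcongr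
      exact Real.one_le_exp hC
    linarith
  have hGall : Icc (0 : ℝ) 1 ⊆ G := by
    refine hGclosed.Icc_subset_of_forall_mem_nhdsGT_of_Icc_subset hG0 fun t ht htG => ?_
    have ht' := Ico_subset_Icc_self ht
    obtain ⟨h₁, h₂, -⟩ := hest t ht' htG
    have hts : γ t ∈ (chartAt 𝔼 x₀).source :=
      hsrc ▸ ((hA_mem _).1 (htG (right_mem_Icc.2 ht.1)).1).1
    have hlt : ‖ψ (γ t) - ψ x₀‖ < r := by
      calc ‖ψ (γ t) - ψ x₀‖ ≤ ‖ψ (γ t) - ψ (γ 0)‖ + ‖ψ (γ 0) - ψ x₀‖ :=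
            norm_sub_le_norm_sub_add_norm_sub ..
        _ < r := by rw [hγ0x] at h₂ ⊢; linarith
    refine mem_nhdsWithin_of_mem_nhds ?_
    filter_upwards [(hsm t ht').continuousAt.preimage_mem_nhds
        ((chartAt 𝔼 x₀).open_source.mem_nhds hts),
      ((hasDerivAt_extChartAt_comp (hsm t ht') hts).continuousAt.sub_const
        (ψ x₀)).norm.eventually_lt_const hlt,
      (hasDerivAt_components_velocity (hsm t ht') hts).continuousAt.norm.eventually_lt_const
        (h₁.trans_lt hv1)] with s hs₁ hs₂ hs₃
    exact ⟨(hA_mem _).2 ⟨hsrc ▸ hs₁, hs₂.le⟩, hs₃.le⟩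
  have h1 : (1 : ℝ) ∈ Icc (0 : ℝ) 1 := right_mem_Icc.2 zero_le_one
  refine ⟨hsrc ▸ ((hA_mem _).1 (hGall h1).1).1, ?_⟩
  have := (hest 1 h1 hGall).2.2
  rwa [one_smul, hγ0x, show u 0 = components x₀ v from hu0] at this

end Geodesics

/-! ### Normal coordinates -/

/-- On a finite-dimensional domain, pointwise differentiability of a family of linear maps is
differentiability in operator norm. -/
theorem differentiableAt_clm_of_forall_apply {n : ℕ} {X F : Type*}
    [NormedAddCommGroup X] [NormedSpace ℝ X] [NormedAddCommGroup F] [NormedSpace ℝ F]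
    {c : X → EuclideanSpace ℝ (Fin n) →L[ℝ] F} {x : X}
    (hc : ∀ u, DifferentiableAt ℝ (fun y => c y u) x) : DifferentiableAt ℝ c x := by
  have key : c = fun y => ∑ i, (EuclideanSpace.proj i : EuclideanSpace ℝ (Fin n) →L[ℝ] ℝ).smulRight
      (c y (EuclideanSpace.basisFun (Fin n) ℝ i)) := by
    funext y
    ext u
    conv_lhs => rw [← (EuclideanSpace.basisFun (Fin n) ℝ).sum_repr u]
    simp [map_sum]
  rw [key]
  exact DifferentiableAt.fun_sum fun i _ =>
    ((ContinuousLinearMap.smulRightL ℝ (EuclideanSpace ℝ (Fin n)) F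
      (EuclideanSpace.proj i)).differentiableAt).comp x (hc _)

section NormalCoordinates

variable {m : ℕ} {M : Type*} [TopologicalSpace M]
  [ChartedSpace (EuclideanSpace ℝ (Fin m)) M] [IsManifold (𝓡 m) ∞ M]

local notation "𝔼" => EuclideanSpace ℝ (Fin m)

theorem expRel_expMap {conn : AffineConnection m M} {ξ : M} {v : TangentSpace (𝓡 m) ξ}
    (hv : v ∈ expDomain conn ξ) : ExpRel conn ξ v (expMap conn ξ v) := by
  have hv' : ∃ z, ExpRel conn ξ v z := hv
  rw [expMap, dif_pos hv']
  exact hv'.choose_spec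

namespace NormalCoordinates

variable {conn : AffineConnection m M} (c : NormalCoordinates conn)

theorem mem_range {ξ : M} {u : 𝔼} : u ∈ c.range ξ ↔ (c.iso ξ).symm u ∈ c.W ξ := by
  constructor
  · rintro ⟨v, hv, rfl⟩
    rwa [ContinuousLinearEquiv.symm_apply_apply]
  · intro hu
    exact ⟨_, hu, ContinuousLinearEquiv.apply_symm_apply _ _⟩

theorem isOpen_range (ξ : M) : IsOpen (c.range ξ) :=
  (c.iso ξ).toHomeomorph.isOpenMap _ (c.isNormalDomain ξ).isOpen

theorem range_mem_nhds_zero (ξ : M) : c.range ξ ∈ 𝓝 0 :=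
  (c.isOpen_range ξ).mem_nhds (c.mem_range.2 (by
    rw [map_zero]
    exact (c.isNormalDomain ξ).zero_mem))

theorem expRel_coordInv {ξ : M} {u : 𝔼} (hu : u ∈ c.range ξ) :
    ExpRel conn ξ ((c.iso ξ).symm u) (c.coordInv ξ u) :=
  expRel_expMap ((c.isNormalDomain ξ).subset_expDomain (c.mem_range.1 hu))

theorem coordInv_mem_U {ξ : M} {u : 𝔼} (hu : u ∈ c.range ξ) : c.coordInv ξ u ∈ c.U ξ :=
  ⟨_, c.mem_range.1 hu, rfl⟩

theorem coord_coordInv {ξ : M} {u : 𝔼} (hu : u ∈ c.range ξ) :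
    c.coord ξ (c.coordInv ξ u) = u := by
  rw [coord, coordInv, expInv,
    (c.isNormalDomain ξ).injOn.leftInvOn_invFunOn (c.mem_range.1 hu),
    ContinuousLinearEquiv.apply_symm_apply]

theorem coordInv_coord {ξ ζ : M} (hζ : ζ ∈ c.U ξ) : c.coordInv ξ (c.coord ξ ζ) = ζ := by
  rw [coord, coordInv, ContinuousLinearEquiv.symm_apply_apply]
  exact Function.invFunOn_eq hζ

theorem contMDiffAt_coordInv_zero (ξ : M) :
    ContMDiffAt 𝓘(ℝ, 𝔼) (𝓡 m) ∞ (c.coordInv ξ) 0 := by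
  have h := (c.isNormalDomain ξ).smooth.contMDiffAt
    ((c.isNormalDomain ξ).isOpen.mem_nhds (c.isNormalDomain ξ).zero_mem)
  let L : 𝔼 →L[ℝ] 𝔼 := ((c.iso ξ).symm : 𝔼 →L[ℝ] TangentSpace (𝓡 m) ξ)
  have hL : ContMDiffAt 𝓘(ℝ, 𝔼) 𝓘(ℝ, 𝔼) ∞ L 0 := L.contMDiff.contMDiffAt
  refine ContMDiffAt.comp_of_eq (g := fun v : 𝔼 => expMap conn ξ v) (f := L) h hL ?_
  exact map_zero L

theorem contMDiffAt_coord {ξ ζ : M} (hζ : ζ ∈ c.U ξ) :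
    ContMDiffAt (𝓡 m) 𝓘(ℝ, 𝔼) ∞ (c.coord ξ) ζ := by
  have h := (c.isNormalDomain ξ).smooth_inv.contMDiffAt
    ((c.isNormalDomain ξ).isOpen_image.mem_nhds hζ)
  let L : 𝔼 →L[ℝ] 𝔼 := (c.iso ξ : TangentSpace (𝓡 m) ξ →L[ℝ] 𝔼)
  exact (L.contMDiff.contMDiffAt).comp ζ h

/-- The matrix of the frame `iso_x⁻¹` at `x` in the coordinate frame of the chart at `x₀`: it sends
`u` to the components of `iso_x⁻¹ u`. -/
noncomputable def frameMap (x₀ x : M) : 𝔼 →L[ℝ] 𝔼 :=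
  ((trivializationAt 𝔼 (fun x : M => TangentSpace (𝓡 m) x) x₀).continuousLinearMapAt ℝ x).comp
    ((c.iso x).symm : 𝔼 →L[ℝ] TangentSpace (𝓡 m) x)

theorem frameMap_apply {x₀ x : M} (hx : x ∈ (chartAt 𝔼 x₀).source) (u : 𝔼) :
    c.frameMap x₀ x u = components x₀ ((c.iso x).symm u) :=
  (components_eq_continuousLinearMapAt hx _).symm

/-- Uniform first-order expansion of `x ⊞ u` in the chart at `x₀`, for `x` near `x₀`. -/
theorem exists_coordInv_estimate [T2Space M]
    (hconn : CovariantDerivative.ContMDiffCovariantDerivative conn ∞) (x₀ : M) :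
    ∃ C δ : ℝ, 0 < δ ∧ ∀ᶠ x in 𝓝 x₀, ∀ u ∈ c.range x, ‖c.frameMap x₀ x u‖ < δ →
      c.coordInv x u ∈ (chartAt 𝔼 x₀).source ∧
      ‖extChartAt (𝓡 m) x₀ (c.coordInv x u) - extChartAt (𝓡 m) x₀ x - c.frameMap x₀ x u‖
        ≤ C * ‖c.frameMap x₀ x u‖ ^ 2 := by
  obtain ⟨C, δ, hδ, h⟩ := exists_expRel_estimate hconn x₀
  refine ⟨C, δ, hδ, ?_⟩
  filter_upwards [h, (chartAt 𝔼 x₀).open_source.mem_nhds (mem_chart_source 𝔼 x₀)] with x hx hxs u hu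
  rw [c.frameMap_apply hxs]
  exact hx _ _ (c.expRel_coordInv hu)

/-- `exp_ξ 0 = ξ`. The defining choice in `expMap` may pick any geodesic with zero initial velocity;
the estimate shows that all of them end at `ξ`. -/
theorem coordInv_zero [T2Space M]
    (hconn : CovariantDerivative.ContMDiffCovariantDerivative conn ∞) (ξ : M) :
    c.coordInv ξ 0 = ξ := by
  obtain ⟨C, δ, hδ, h⟩ := c.exists_coordInv_estimate hconn ξ
  obtain ⟨h₁, h₂⟩ := h.self_of_nhds 0 (mem_of_mem_nhds (c.range_mem_nhds_zero ξ))
    (by rwa [map_zero, norm_zero])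
  rw [map_zero, sub_zero, norm_zero, zero_pow two_ne_zero, mul_zero, norm_le_zero_iff,
    sub_eq_zero] at h₂
  exact (extChartAt (𝓡 m) ξ).injOn (by rwa [extChartAt_source]) (mem_extChartAt_source ξ) h₂

theorem mem_U_self [T2Space M]
    (hconn : CovariantDerivative.ContMDiffCovariantDerivative conn ∞) (ξ : M) : ξ ∈ c.U ξ := by
  have := c.coordInv_mem_U (mem_of_mem_nhds (c.range_mem_nhds_zero ξ))
  rwa [c.coordInv_zero hconn] at this

theorem coord_self [T2Space M]
    (hconn : CovariantDerivative.ContMDiffCovariantDerivative conn ∞) (ξ : M) :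
    c.coord ξ ξ = 0 := by
  have := c.coord_coordInv (mem_of_mem_nhds (c.range_mem_nhds_zero ξ))
  rwa [c.coordInv_zero hconn] at this

/-- The differential of `exp_ξ` at `0` is the identity, written in the chart at `ξ`. -/
theorem hasFDerivAt_extChartAt_coordInv [T2Space M]
    (hconn : CovariantDerivative.ContMDiffCovariantDerivative conn ∞) (ξ : M) :
    HasFDerivAt (fun u => extChartAt (𝓡 m) ξ (c.coordInv ξ u)) (c.frameMap ξ ξ) 0 := by
  obtain ⟨C, δ, hδ, h⟩ := c.exists_coordInv_estimate hconn ξ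
  have h := h.self_of_nhds
  have hlim : Tendsto (fun u => ‖c.frameMap ξ ξ u‖) (𝓝 0) (𝓝 0) := by
    simpa using (c.frameMap ξ ξ).continuous.norm.tendsto 0
  have hO : (fun u => extChartAt (𝓡 m) ξ (c.coordInv ξ u) - extChartAt (𝓡 m) ξ ξ -
      c.frameMap ξ ξ u) =O[𝓝 0] fun u => ‖u‖ ^ 2 := by
    refine (IsBigO.of_bound C ?_).trans
      (((c.frameMap ξ ξ).isBigO_id (𝓝 0)).norm_norm.pow 2)
    filter_upwards [hlim.eventually_lt_const hδ, c.range_mem_nhds_zero ξ] with u hu hu'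
    simpa using (h u hu' hu).2
  rw [hasFDerivAt_iff_isLittleO_nhds_zero]
  simp only [zero_add, c.coordInv_zero hconn]
  exact hO.trans_isLittleO (by simpa using isLittleO_norm_pow_id (E' := 𝔼) one_lt_two)

/-- The normal coordinates around `ξ`, read in the chart at `ξ`. -/
noncomputable def coordInChart (ξ : M) (p : 𝔼) : 𝔼 := c.coord ξ ((extChartAt (𝓡 m) ξ).symm p)

theorem coordInChart_extChartAt {ξ ζ : M} (hζ : ζ ∈ (chartAt 𝔼 ξ).source) :
    c.coordInChart ξ (extChartAt (𝓡 m) ξ ζ) = c.coord ξ ζ := by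
  rw [coordInChart, (extChartAt (𝓡 m) ξ).left_inv (by rwa [extChartAt_source])]

theorem contDiffAt_coordInChart [T2Space M]
    (hconn : CovariantDerivative.ContMDiffCovariantDerivative conn ∞) (ξ : M) :
    ContDiffAt ℝ ∞ (c.coordInChart ξ) (extChartAt (𝓡 m) ξ ξ) := by
  have h₁ : ContMDiffAt 𝓘(ℝ, 𝔼) (𝓡 m) ∞ (extChartAt (𝓡 m) ξ).symm (extChartAt (𝓡 m) ξ ξ) :=
    (contMDiffOn_extChartAt_symm ξ).contMDiffAt (extChartAt_target_mem_nhds ξ)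
  exact contMDiffAt_iff_contDiffAt.1 ((c.contMDiffAt_coord (c.mem_U_self hconn ξ)).comp_of_eq h₁
    (extChartAt_to_inv ξ))

theorem fderiv_coordInChart_comp_frameMap [T2Space M]
    (hconn : CovariantDerivative.ContMDiffCovariantDerivative conn ∞) (ξ : M) :
    (fderiv ℝ (c.coordInChart ξ) (extChartAt (𝓡 m) ξ ξ)).comp (c.frameMap ξ ξ) =
      ContinuousLinearMap.id ℝ 𝔼 := by
  have hf := ((c.contDiffAt_coordInChart hconn ξ).differentiableAt (by simp)).hasFDerivAt
  have hk := c.hasFDerivAt_extChartAt_coordInv hconn ξ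
  have hfk := HasFDerivAt.comp (g := c.coordInChart ξ)
    (g' := fderiv ℝ (c.coordInChart ξ) (extChartAt (𝓡 m) ξ ξ)) 0
    (by rw [c.coordInv_zero hconn]; exact hf) hk
  refine hfk.unique ((hasFDerivAt_id (𝕜 := ℝ) (0 : 𝔼)).congr_of_eventuallyEq ?_)
  have hcont := (c.contMDiffAt_coordInv_zero ξ).continuousAt
  filter_upwards [c.range_mem_nhds_zero ξ, hcont.preimage_mem_nhds
    ((chartAt 𝔼 ξ).open_source.mem_nhds (by
      rw [c.coordInv_zero hconn]
      exact mem_chart_source 𝔼 ξ))] with u hu hu'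
  rw [Function.comp_apply, c.coordInChart_extChartAt hu', c.coord_coordInv hu, id]

theorem differentiableAt_frameMap_comp {X : Type*} [NormedAddCommGroup X] [NormedSpace ℝ X]
    {x₀ : M} (hc : c.FrameDifferentiableAt x₀) {H : X → M} {p : X} (hp : H p = x₀)
    (hH : MDifferentiableAt 𝓘(ℝ, X) (𝓡 m) H p) :
    DifferentiableAt ℝ (fun q => c.frameMap x₀ (H q)) p := by
  refine differentiableAt_clm_of_forall_apply fun u => ?_
  have h₁ := ((mdifferentiableAt_totalSpace _ _).1 (hc u)).2
  rw [← mdifferentiableAt_iff_differentiableAt]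
  subst hp
  refine (h₁.comp p hH).congr_of_eventuallyEq ?_
  filter_upwards [hH.continuousAt.preimage_mem_nhds
    ((chartAt 𝔼 (H p)).open_source.mem_nhds (mem_chart_source 𝔼 (H p)))] with q hq
  exact c.frameMap_apply hq u

end NormalCoordinates
end NormalCoordinates

/-! ### Expansion of the innovation -/

section Innovation

theorem contDiffAt_extChartAt_comp_coordInv {m n : ℕ} {M N : Type*}
    [TopologicalSpace M] [T2Space M]
    [ChartedSpace (EuclideanSpace ℝ (Fin m)) M] [IsManifold (𝓡 m) ∞ M]
    [TopologicalSpace N] [ChartedSpace (EuclideanSpace ℝ (Fin n)) N]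
    {connM : AffineConnection m M}
    (hconnM : CovariantDerivative.ContMDiffCovariantDerivative connM ∞)
    (ϑ : NormalCoordinates connM) {h : M → N} {ξhat : M}
    (hh : ContMDiffAt (𝓡 m) (𝓡 n) 2 h ξhat) :
    ContDiffAt ℝ 2 (fun ε => extChartAt (𝓡 n) (h ξhat) (h (ϑ.coordInv ξhat ε))) 0 := by
  have hH : ContMDiffAt 𝓘(ℝ, EuclideanSpace ℝ (Fin m)) (𝓡 n) 2
      (fun ε => h (ϑ.coordInv ξhat ε)) 0 :=
    hh.comp_of_eq ((ϑ.contMDiffAt_coordInv_zero ξhat).of_le (WithTop.coe_le_coe.2 le_top))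
      (ϑ.coordInv_zero hconnM ξhat)
  exact contMDiffAt_iff_contDiffAt.1 ((contMDiffAt_extChartAt (x := h ξhat)).comp_of_eq hH
    (by rw [ϑ.coordInv_zero hconnM]))

variable {m n : ℕ} {M N : Type*}
  [TopologicalSpace M] [T2Space M]
  [ChartedSpace (EuclideanSpace ℝ (Fin m)) M] [IsManifold (𝓡 m) ∞ M]
  [TopologicalSpace N] [T2Space N]
  [ChartedSpace (EuclideanSpace ℝ (Fin n)) N] [IsManifold (𝓡 n) ∞ N]
  {connM : AffineConnection m M} {connN : AffineConnection n N}

local notation "𝔼m" => EuclideanSpace ℝ (Fin m)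
local notation "𝔼n" => EuclideanSpace ℝ (Fin n)

theorem outputMatrix_eq_fderiv
    (hconnM : CovariantDerivative.ContMDiffCovariantDerivative connM ∞)
    (hconnN : CovariantDerivative.ContMDiffCovariantDerivative connN ∞)
    (ϑ : NormalCoordinates connM) (φ : NormalCoordinates connN)
    {h : M → N} {ξhat : M} (hh : ContMDiffAt (𝓡 m) (𝓡 n) 2 h ξhat) :
    outputMatrix ϑ φ h ξhat =
      (fderiv ℝ (φ.coordInChart (h ξhat)) (extChartAt (𝓡 n) (h ξhat) (h ξhat))).comp
        (fderiv ℝ (fun ε => extChartAt (𝓡 n) (h ξhat) (h (ϑ.coordInv ξhat ε))) 0) := by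
  have h0 := ϑ.coordInv_zero hconnM ξhat
  have d₁ : MDifferentiableAt 𝓘(ℝ, 𝔼m) (𝓡 m) (ϑ.coordInv ξhat) 0 :=
    (ϑ.contMDiffAt_coordInv_zero ξhat).mdifferentiableAt (by simp)
  have d₂ : MDifferentiableAt (𝓡 m) (𝓡 n) h ξhat := hh.mdifferentiableAt (by simp)
  have d₃ : MDifferentiableAt (𝓡 n) 𝓘(ℝ, 𝔼n) (φ.coord (h ξhat)) (h ξhat) :=
    (φ.contMDiffAt_coord (φ.mem_U_self hconnN _)).mdifferentiableAt (by simp)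
  have d₂' : MDifferentiableAt (𝓡 m) (𝓡 n) h (ϑ.coordInv ξhat 0) := by rwa [h0]
  have d₃' : MDifferentiableAt (𝓡 n) 𝓘(ℝ, 𝔼n) (φ.coord (h ξhat)) (h (ϑ.coordInv ξhat 0)) := by
    rwa [h0]
  have e₁ : outputMatrix ϑ φ h ξhat =
      fderiv ℝ (fun ε => φ.coord (h ξhat) (h (ϑ.coordInv ξhat ε))) 0 := by
    -- The base points `ϑ⁻¹(0)` and `ξhat` agree, so the derivatives there agree as linear maps
    -- between the model spaces.
    let D₂ : M → 𝔼m →L[ℝ] 𝔼n := fun x => mfderiv (𝓡 m) (𝓡 n) h x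
    let D₃ : N → 𝔼n →L[ℝ] 𝔼n := fun y => mfderiv (𝓡 n) 𝓘(ℝ, 𝔼n) (φ.coord (h ξhat)) y
    let D₁ : 𝔼m →L[ℝ] 𝔼m := mfderiv 𝓘(ℝ, 𝔼m) (𝓡 m) (ϑ.coordInv ξhat) 0
    have key : fderiv ℝ (fun ε => φ.coord (h ξhat) (h (ϑ.coordInv ξhat ε))) 0 =
        (D₃ (h (ϑ.coordInv ξhat 0))).comp ((D₂ (ϑ.coordInv ξhat 0)).comp D₁) := by
      rw [← mfderiv_eq_fderiv]
      exact (mfderiv_comp (0 : 𝔼m) d₃' (d₂'.comp (0 : 𝔼m) d₁)).trans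
        (congrArg (fun L : 𝔼m →L[ℝ] 𝔼n => (D₃ (h (ϑ.coordInv ξhat 0))).comp L)
          (mfderiv_comp (0 : 𝔼m) d₂' d₁))
    rw [key, h0]
    rfl
  rw [e₁]
  have hg := contDiffAt_extChartAt_comp_coordInv hconnM ϑ hh
  have hf := (φ.contDiffAt_coordInChart hconnN (h ξhat)).differentiableAt (by simp)
  have hfg := HasFDerivAt.comp (g := φ.coordInChart (h ξhat))
    (g' := fderiv ℝ (φ.coordInChart (h ξhat)) (extChartAt (𝓡 n) (h ξhat) (h ξhat))) (0 : 𝔼m)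
    (by rw [h0]; exact hf.hasFDerivAt) (hg.differentiableAt (by simp)).hasFDerivAt
  refine (hfg.congr_of_eventuallyEq ?_).fderiv
  have hcont : ContinuousAt (fun ε => h (ϑ.coordInv ξhat ε)) 0 :=
    ContinuousAt.comp (g := h) (by rw [h0]; exact hh.continuousAt) d₁.continuousAt
  filter_upwards [hcont.preimage_mem_nhds ((chartAt 𝔼n (h ξhat)).open_source.mem_nhds (by
    rw [h0]; exact mem_chart_source _ _))] with ε hε
  exact (φ.coordInChart_extChartAt hε).symm

/-- The expansion of the innovation along any filter on the pairs `(ε, ν)` that converges to `0` and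
is eventually supported where `h ξ ⊞ ν` is meaningful. The parametrization by `ε` instead of `ξ`
turns the claim into one about maps between vector spaces. -/
theorem innovation_isBigO
    (hconnM : CovariantDerivative.ContMDiffCovariantDerivative connM ∞)
    (hconnN : CovariantDerivative.ContMDiffCovariantDerivative connN ∞)
    (ϑ : NormalCoordinates connM) (φ : NormalCoordinates connN)
    {h : M → N} {ξhat : M} (hh : ContMDiffAt (𝓡 m) (𝓡 n) 2 h ξhat)
    (hφ : φ.FrameDifferentiableAt (h ξhat)) {l : Filter (𝔼m × 𝔼n)} (hl : l ≤ 𝓝 0)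
    (hlr : ∀ᶠ p in l, p.2 ∈ φ.range (h (ϑ.coordInv ξhat p.1))) :
    (∀ᶠ p in l, φ.boxplus (h (ϑ.coordInv ξhat p.1)) p.2 ∈ φ.U (h ξhat)) ∧
    (fun p => φ.boxminus (φ.boxplus (h (ϑ.coordInv ξhat p.1)) p.2) (h ξhat) -
      (outputMatrix ϑ φ h ξhat p.1 + p.2)) =O[l] fun p => ‖p‖ ^ 2 := by
  set yhat := h ξhat with hyhat
  set H : 𝔼m → N := fun ε => h (ϑ.coordInv ξhat ε) with hH
  set ψ := extChartAt (𝓡 n) yhat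
  have hH0 : H 0 = yhat := by rw [hH, hyhat]; exact congrArg h (ϑ.coordInv_zero hconnM ξhat)
  have hHd : MDifferentiableAt 𝓘(ℝ, 𝔼m) (𝓡 n) H 0 :=
    (hh.comp_of_eq ((ϑ.contMDiffAt_coordInv_zero ξhat).of_le (WithTop.coe_le_coe.2 le_top))
      (ϑ.coordInv_zero hconnM ξhat)).mdifferentiableAt (by simp)
  set y : 𝔼m × 𝔼n → N := fun p => φ.coordInv (H p.1) p.2
  have h₁ : Tendsto (Prod.fst : 𝔼m × 𝔼n → 𝔼m) l (𝓝 0) := (continuous_fst.tendsto 0).mono_left hl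
  have hO₁ : (Prod.fst : 𝔼m × 𝔼n → 𝔼m) =O[l] fun p => ‖p‖ := isBigO_fst_prod'.norm_right
  have hO₂ : (Prod.snd : 𝔼m × 𝔼n → 𝔼n) =O[l] fun p => ‖p‖ := isBigO_snd_prod'.norm_right
  have hp0 : Tendsto (fun p : 𝔼m × 𝔼n => ‖p‖) l (𝓝 0) := by
    simpa using (continuous_norm.tendsto (0 : 𝔼m × 𝔼n)).mono_left hl
  have hsq : (fun p : 𝔼m × 𝔼n => ‖p‖ ^ 2) =O[l] fun p => ‖p‖ := by
    simpa [pow_two] using (hp0.isBigO_one ℝ).mul (isBigO_refl (fun p : 𝔼m × 𝔼n => ‖p‖) l)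
  -- By differentiability of the frame, replacing `A (H ε)` by `A ŷ` costs `O(‖ε‖ ‖ν‖)`.
  have hfr : DifferentiableAt ℝ (fun ε => φ.frameMap yhat (H ε)) 0 :=
    φ.differentiableAt_frameMap_comp hφ hH0 hHd
  have hfr₁ : (fun p : 𝔼m × 𝔼n => φ.frameMap yhat (H p.1) - φ.frameMap yhat yhat) =O[l]
      fun p => ‖p‖ := by
    have := hfr.isBigO_sub.comp_tendsto h₁
    simp only [hH0, sub_zero] at this
    exact this.trans hO₁
  have hfr₂ : (fun p : 𝔼m × 𝔼n => φ.frameMap yhat (H p.1) p.2 - φ.frameMap yhat yhat p.2) =O[l]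
      fun p => ‖p‖ ^ 2 := by
    have : (fun p : 𝔼m × 𝔼n => (φ.frameMap yhat (H p.1) - φ.frameMap yhat yhat) p.2) =O[l]
        fun p => ‖p‖ * ‖p‖ :=
      (IsBigO.of_bound 1 (Eventually.of_forall fun p => by
        rw [one_mul, norm_mul, norm_norm, norm_norm]
        exact ContinuousLinearMap.le_opNorm _ _)).trans (hfr₁.norm_left.mul hO₂.norm_left)
    simpa only [sub_apply, ← pow_two] using this
  have hfr₃ : (fun p : 𝔼m × 𝔼n => φ.frameMap yhat (H p.1) p.2) =O[l] fun p => ‖p‖ := by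
    have := (hfr₂.trans hsq).add (((φ.frameMap yhat yhat).isBigO_comp _ l).trans hO₂)
    simpa using this
  -- `H ε ⊞ ν` is `H ε + A (H ε) ν` in the chart, up to `O(‖ν‖²)`.
  obtain ⟨C, δ, hδ, hest⟩ := φ.exists_coordInv_estimate hconnN yhat
  have hest' : ∀ᶠ p in l, y p ∈ (chartAt 𝔼n yhat).source ∧
      ‖ψ (y p) - ψ (H p.1) - φ.frameMap yhat (H p.1) p.2‖
        ≤ C * ‖φ.frameMap yhat (H p.1) p.2‖ ^ 2 := by
    have hHt : Tendsto (fun p : 𝔼m × 𝔼n => H p.1) l (𝓝 yhat) := by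
      have := hHd.continuousAt.tendsto.comp h₁
      rwa [hH0] at this
    have h₀ : Tendsto (fun p : 𝔼m × 𝔼n => ‖φ.frameMap yhat (H p.1) p.2‖) l (𝓝 0) := by
      simpa using (hfr₃.trans_tendsto hp0).norm
    filter_upwards [hHt.eventually hest, hlr, h₀.eventually_lt_const hδ] with p hp₁ hp₂ hp₃
    exact hp₁ _ hp₂ hp₃
  have hgeo : (fun p => ψ (y p) - ψ (H p.1) - φ.frameMap yhat (H p.1) p.2) =O[l]
      fun p => ‖p‖ ^ 2 := by
    refine (IsBigO.of_bound C ?_).trans (hfr₃.norm_left.pow 2)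
    filter_upwards [hest'] with p hp
    simpa using hp.2
  -- Expansion of the output map at `ε = 0`.
  set g : 𝔼m → 𝔼n := fun ε => ψ (H ε) with hg
  have hgT : (fun p : 𝔼m × 𝔼n => g p.1 - ψ yhat - fderiv ℝ g 0 p.1) =O[l] fun p => ‖p‖ ^ 2 := by
    have := (taylor_isBigO_sq
      (contDiffAt_extChartAt_comp_coordInv hconnM ϑ hh)).comp_tendsto h₁
    have h2 := this.trans (k := fun p : 𝔼m × 𝔼n => ‖p‖ ^ 2)
      (by simpa [Function.comp_def] using hO₁.norm_left.pow 2)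
    refine h2.congr_left fun p => ?_
    simp only [Function.comp_apply, sub_zero]
    rw [show h (ϑ.coordInv ξhat 0) = yhat from hH0]
  have hw : (fun p => ψ (y p) - ψ yhat - (fderiv ℝ g 0 p.1 + φ.frameMap yhat yhat p.2)) =O[l]
      fun p => ‖p‖ ^ 2 := by
    refine ((hgeo.add hgT).add hfr₂).congr_left fun p => ?_
    simp only [hg]
    abel
  have hw₁ : (fun p => ψ (y p) - ψ yhat) =O[l] fun p => ‖p‖ := by
    have := (hw.trans hsq).add ((((fderiv ℝ g 0).isBigO_comp _ l).trans hO₁).add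
      (((φ.frameMap yhat yhat).isBigO_comp _ l).trans hO₂))
    refine this.congr_left fun p => ?_
    abel
  have hψy : Tendsto (fun p => ψ (y p)) l (𝓝 (ψ yhat)) :=
    tendsto_sub_nhds_zero_iff.1 (hw₁.trans_tendsto hp0)
  refine ⟨?_, ?_⟩
  · have hsymm : Tendsto (fun p => ψ.symm (ψ (y p))) l (𝓝 yhat) := by
      have := (continuousAt_extChartAt_symm (I := 𝓡 n) yhat).tendsto.comp hψy
      rwa [extChartAt_to_inv] at this
    filter_upwards [hest', hsymm.eventually ((φ.isNormalDomain yhat).isOpen_image.mem_nhds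
      (φ.mem_U_self hconnN yhat))] with p hp hp'
    rwa [ψ.left_inv (by rw [extChartAt_source]; exact hp.1)] at hp'
  · set f := φ.coordInChart yhat
    have hfT := (taylor_isBigO_sq ((φ.contDiffAt_coordInChart hconnN yhat).of_le
      (m := 2) (WithTop.coe_le_coe.2 le_top))).comp_tendsto hψy
    have hfT' := hfT.trans (k := fun p : 𝔼m × 𝔼n => ‖p‖ ^ 2) (hw₁.norm_left.pow 2)
    have hlin := ((fderiv ℝ f (ψ yhat)).isBigO_comp _ l).trans hw
    have hid := φ.fderiv_coordInChart_comp_frameMap hconnN yhat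
    refine (hfT'.add hlin).congr' ?_ EventuallyEq.rfl
    filter_upwards [hest'] with p hp
    have hid' : fderiv ℝ f (ψ yhat) (φ.frameMap yhat yhat p.2) = p.2 :=
      congrArg (fun L : 𝔼n →L[ℝ] 𝔼n => L p.2) hid
    have hC : outputMatrix ϑ φ h ξhat p.1 = fderiv ℝ f (ψ yhat) (fderiv ℝ g 0 p.1) :=
      congrArg (fun L : 𝔼m →L[ℝ] 𝔼n => L p.1) (outputMatrix_eq_fderiv hconnM hconnN ϑ φ hh)
    have hf₁ : f (ψ (y p)) = φ.coord yhat (y p) := φ.coordInChart_extChartAt hp.1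
    have hf₀ : f (ψ yhat) = 0 := by
      exact (φ.coordInChart_extChartAt (mem_chart_source _ _)).trans (φ.coord_self hconnN _)
    change f (ψ (y p)) - f (ψ yhat) - fderiv ℝ f (ψ yhat) (ψ (y p) - ψ yhat) +
      fderiv ℝ f (ψ yhat) (ψ (y p) - ψ yhat -
        (fderiv ℝ g 0 p.1 + φ.frameMap yhat yhat p.2)) = φ.coord yhat (y p) - _
    rw [hf₁, hf₀, map_sub _ (ψ (y p) - ψ yhat), map_add _ (fderiv ℝ g 0 p.1),
      hid', ← hC]
    abel

end Innovation
end ManifoldEKF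

theorem lemma2 {m n : ℕ} {M N : Type*}
    [TopologicalSpace M] [T2Space M]
    [ChartedSpace (EuclideanSpace ℝ (Fin m)) M] [IsManifold (𝓡 m) ∞ M]
    [TopologicalSpace N] [T2Space N]
    [ChartedSpace (EuclideanSpace ℝ (Fin n)) N] [IsManifold (𝓡 n) ∞ N]
    (connM : ManifoldEKF.AffineConnection m M)
    (hconnM : CovariantDerivative.ContMDiffCovariantDerivative connM ∞)
    (connN : ManifoldEKF.AffineConnection n N)
    (hconnN : CovariantDerivative.ContMDiffCovariantDerivative connN ∞)
    (ϑ : ManifoldEKF.NormalCoordinates connM) (φ : ManifoldEKF.NormalCoordinates connN)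
    (h : M → N) (ξhat : M) (hh : ContMDiffAt (𝓡 m) (𝓡 n) 2 h ξhat)
    (hφ : φ.FrameDifferentiableAt (h ξhat)) :
    ∃ K δ : ℝ, 0 < δ ∧
      ∀ ξ ∈ ϑ.U ξhat, ∀ ν ∈ φ.range (h ξ),
        ∀ ε, ε = ϑ.boxminus ξ ξhat →
        ∀ y, y = φ.boxplus (h ξ) ν →
        ‖ε‖ < δ → ‖ν‖ < δ →
          y ∈ φ.U (h ξhat) ∧
          ‖φ.boxminus y (h ξhat) - (ManifoldEKF.outputMatrix ϑ φ h ξhat ε + ν)‖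
            ≤ K * (‖ε‖ ^ 2 + ‖ν‖ ^ 2) := by
  -- The pairs `(ε, ν)` for which `h ξ ⊞ ν` is meaningful, where `ξ = ξhat ⊞ ε`.
  set S : Set (EuclideanSpace ℝ (Fin m) × EuclideanSpace ℝ (Fin n)) :=
    {p | p.2 ∈ φ.range (h (ϑ.coordInv ξhat p.1))}
  obtain ⟨hU, hO⟩ := ManifoldEKF.innovation_isBigO hconnM hconnN ϑ φ hh hφ
    (l := 𝓝[S] 0) nhdsWithin_le_nhds self_mem_nhdsWithin
  obtain ⟨K, hK, hbound⟩ := hO.exists_nonneg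
  obtain ⟨δ, hδ, hball⟩ := Metric.mem_nhdsWithin_iff.1 (hU.and hbound.bound)
  refine ⟨K, δ, hδ, ?_⟩
  rintro ξ hξ ν hν ε hε y rfl hεδ hνδ
  have hξε : ϑ.coordInv ξhat ε = ξ := by
    rw [hε]
    exact ϑ.coordInv_coord hξ
  have hmem : (ε, ν) ∈ Metric.ball 0 δ ∩ S := by
    refine ⟨?_, ?_⟩
    · rw [mem_ball_zero_iff, Prod.norm_mk]
      exact max_lt hεδ hνδ
    · change ν ∈ φ.range (h (ϑ.coordInv ξhat ε))
      rwa [hξε]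
  obtain ⟨h₁, h₂⟩ := hball hmem
  simp only [hξε] at h₁ h₂
  refine ⟨h₁, h₂.trans (mul_le_mul_of_nonneg_left ?_ hK)⟩
  rw [norm_pow, norm_norm, Prod.norm_mk]
  rcases max_cases ‖ε‖ ‖ν‖ with ⟨h, -⟩ | ⟨h, -⟩ <;> rw [h] <;> nlinarith [sq_nonneg ‖ε‖, sq_nonneg ‖ν‖]
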